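/- **Compactness Theorem.** Let $\mathcal{A}$ be a locally small category that is strongly locally ranked with respect to a left-proper factorization system $(\mathcal{E},\mathcal{M})$ (defined below), let $\mathcal{H}$ be a set of finitary morphisms of $\mathcal{A}$, and let $h$ be a finitary morphism of $\mathcal{A}$. If $h$ is an injectivity consequence of $\mathcal{H}$, then there is a finite subset $\mathcal{H}'\subseteq\mathcal{H}$ such that $h$ is an injectivity consequence of $\mathcal{H}'$. Definitions. * An object $X$ is *injective* with respect to $f:A\to B$ if every morphism $A\to X$ factors through $f$. A morphism $h$ is an *injectivity consequence* of a set $\mathcal{H}$ of morphisms if every object injective with respect to all members of $\mathcal{H}$ is injective with respect to $h$. * A *factorization system* is a pair $(\mathcal{E},\mathcal{M})$ of classes of morphisms, each containing all isomorphisms and closed under composition, such that every morphism $f$ factors as $f=m\cdot e$ with $e\in\mathcal{E}$, $m\in\mathcal{M}$, and for any other such factorization $f=m'\cdot e'$ there is a unique morphism $d$ with $d\cdot e=e'$ and $m'\cdot d=m$. It is *left-proper* if every member of $\mathcal{E}$ is an epimorphism; an *$\mathcal{E}$-quotient* of $A$ is then a quotient object of $A$ represented by a morphism of $\mathcal{E}$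 with domain $A$. * For a regular (infinite) cardinal $\lambda$, an object $A$ *has $\mathcal{M}$-rank $\lambda$* if $\hom(A,-)$ preserves colimits of small $\lambda$-filtered diagrams whose connecting morphisms lie in $\mathcal{M}$, and $A$ has fewer than $\lambda$ $\mathcal{E}$-quotients. It has *finite $\mathcal{M}$-rank* if it has $\mathcal{M}$-rank $\aleph_0$. A morphism is *finitary* if its domain and codomain have finite $\mathcal{M}$-rank. * $\mathcal{A}$ is *strongly locally ranked* with respect to the left-proper factorization system $(\mathcal{E},\mathcal{M})$ if: (i) $\mathcal{A}$ is cocomplete; (ii) every object has $\mathcal{M}$-rank $\lambda$ for some regular cardinal $\lambda$, and for each regular cardinal $\lambda$ the objects of $\mathcal{M}$-rank $\lambda$ form a set up to isomorphism; (iii) for each regular cardinal $\mu$ the objects of $\mathcal{M}$-rank $\mu$ are closed under $\mathcal{E}$-quotients and under colimits of diagrams with fewer than $\mu$ morphisms; (iv) for every small filtered diagram with connecting morphisms in $\mathcal{M}$, the colimit cocone consists of morphisms of $\mathcal{M}$, and for every other cocone of $\mathcal{M}$-morphisms the factorizing morphism lies in $\mathcal{M}$. -/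

import Mathlib

universe v u

namespace InjectivityLogic

open CategoryTheory Limits Opposite

variable {C : Type u} [Category.{v} C]

/-- `X` is injective with respect to `h : A ⟶ B`: every morphism from `A` to `X` factors
through `h`. -/
def IsInjectiveWrt (X : C) {A B : C} (h : A ⟶ B) : Prop :=
  ∀ u : A ⟶ X, ∃ w : B ⟶ X, h ≫ w = u

/-- `h` is an injectivity consequence of `H`: every object that is injective with respect to all
members of `H` is injective with respect to `h`. -/
def IsInjectivityConsequence (H : Set (Arrow C)) {A B : C} (h : A ⟶ B) : Prop :=
  ∀ X : C, (∀ f ∈ H, IsInjectiveWrt X f.hom) → IsInjectiveWrt X h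

/-- A factorization system `(E, M)`. -/
structure IsFactorizationSystem (E M : MorphismProperty C) : Prop where
  left_iso : ∀ ⦃A B : C⦄ (f : A ⟶ B), IsIso f → E f
  right_iso : ∀ ⦃A B : C⦄ (f : A ⟶ B), IsIso f → M f
  left_comp : ∀ ⦃X Y Z : C⦄ (f : X ⟶ Y) (g : Y ⟶ Z), E f → E g → E (f ≫ g)
  right_comp : ∀ ⦃X Y Z : C⦄ (f : X ⟶ Y) (g : Y ⟶ Z), M f → M g → M (f ≫ g)
  fac : ∀ ⦃A B : C⦄ (f : A ⟶ B), ∃ (Z : C) (e : A ⟶ Z) (m : Z ⟶ B), E e ∧ M m ∧ e ≫ m = f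
  diagonal : ∀ ⦃A B Z Z' : C⦄ (e : A ⟶ Z) (m : Z ⟶ B) (e' : A ⟶ Z') (m' : Z' ⟶ B),
    E e → M m → E e' → M m' → e ≫ m = e' ≫ m' → ∃! d : Z ⟶ Z', e ≫ d = e' ∧ d ≫ m' = m

/-- The `E`-quotients of `A`: isomorphism classes, in the category of objects under `A`, of the
morphisms of `E` with domain `A`. When the members of `E` are epimorphisms these are the quotient
objects of `A` that are represented by morphisms of `E`. -/
def EQuotient (E : MorphismProperty C) (A : C) : Type (max u v) :=
  Quotient (isIsomorphicSetoid (ObjectProperty.FullSubcategory fun B : Under A => E B.hom))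

/-- The property of objects `A` to have `M`-rank `κ`, for a regular cardinal `κ`, with respect to
`(E, M)`: `Hom(A, -)` preserves the colimits of `κ`-filtered diagrams with connecting morphisms
in `M`, and `A` has fewer than `κ` `E`-quotients. -/
structure HasRank (E M : MorphismProperty C) (κ : Cardinal.{v}) [Fact κ.IsRegular] (A : C) :
    Prop where
  preservesColimit : ∀ (J : Type v) [SmallCategory J] [IsCardinalFiltered J κ] (D : J ⥤ C),
    (∀ ⦃i j : J⦄ (f : i ⟶ j), M (D.map f)) → PreservesColimit D (coyoneda.obj (op A))
  quotients_lt : HasCardinalLT (EQuotient E A) κ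

/-- The property of objects to have `M`-rank `κ`, as an `ObjectProperty`. -/
def rankProperty (E M : MorphismProperty C) (κ : Cardinal.{v}) [Fact κ.IsRegular] :
    ObjectProperty C :=
  fun A => HasRank E M κ A

/-- The category `C`, with its left-proper factorization system `(E, M)`, is strongly locally
ranked. -/
structure IsStronglyLocallyRanked (E M : MorphismProperty C) : Prop where
  factorizationSystem : IsFactorizationSystem E M
  leftProper : ∀ ⦃A B : C⦄ (e : A ⟶ B), E e → Epi e
  cocomplete : HasColimits C
  exists_rank : ∀ A : C, ∃ (κ : Cardinal.{v}) (_ : Fact κ.IsRegular), HasRank E M κ A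
  essentiallySmall_rank : ∀ (κ : Cardinal.{v}) [Fact κ.IsRegular],
    ObjectProperty.EssentiallySmall.{v} (rankProperty E M κ)
  rank_quotient : ∀ (κ : Cardinal.{v}) [Fact κ.IsRegular] ⦃A B : C⦄ (e : A ⟶ B),
    E e → HasRank E M κ A → HasRank E M κ B
  /-- closure under colimits of diagrams with fewer than `κ` morphisms -/
  rank_colimit : ∀ (κ : Cardinal.{v}) [Fact κ.IsRegular] (J : Type v) [SmallCategory J],
    HasCardinalLT (Arrow J) κ → ∀ (D : J ⥤ C) (c : Cocone D), IsColimit c →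
      (∀ j : J, HasRank E M κ (D.obj j)) → HasRank E M κ c.pt
  /-- The objects of `C` and the morphisms of `M` form a subcategory closed under filtered
  colimits: the colimit cocone lies in `M` ... -/
  filtered_cocone : ∀ (J : Type v) [SmallCategory J] [IsFiltered J] (D : J ⥤ C),
    (∀ ⦃i j : J⦄ (f : i ⟶ j), M (D.map f)) →
      ∀ (c : Cocone D), IsColimit c → ∀ j : J, M (c.ι.app j)
  /-- ... and the factorization of every other cocone of morphisms of `M` lies in `M`. -/
  filtered_desc : ∀ (J : Type v) [SmallCategory J] [IsFiltered J] (D : J ⥤ C),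
    (∀ ⦃i j : J⦄ (f : i ⟶ j), M (D.map f)) →
      ∀ (c : Cocone D) (hc : IsColimit c) (s : Cocone D),
        (∀ j : J, M (s.ι.app j)) → M (hc.desc s)

/-- `A` has finite `M`-rank, that is, `M`-rank `ℵ₀`. -/
def HasFiniteRank (E M : MorphismProperty C) (A : C) : Prop :=
  haveI := Cardinal.fact_isRegular_aleph0.{v}
  HasRank E M Cardinal.aleph0.{v} A

/-- A morphism is finitary if its domain and its codomain have finite `M`-rank. -/
def IsFinitary (E M : MorphismProperty C) {A B : C} (_h : A ⟶ B) : Prop :=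
  HasFiniteRank E M A ∧ HasFiniteRank E M B

end InjectivityLogic

namespace InjectivityLogic

open CategoryTheory Limits Opposite

variable {C : Type u} [Category.{v} C] {E M : MorphismProperty C}

/-! Suppose every finite `i ⊆ H` admits an object `X i` injective for `i` but not for `h`. A reduced
product of the `X i` modulo final segments would be injective for all of `H` but not for `h`.
Products may fail to commute with what is needed, so it is replaced by the colimit of finite-rank
objects `P` over germs of families `P ⟶ X i`. This index category is filtered, since finite rank is
stable under finite colimits.

Rank controls only diagrams in `M`, and this one need not be such. Finiteness of quotients helps:
images of connecting morphisms stabilize (`exists_stable_image`), giving an `M`-diagram with the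
same colimit (`exists_image_diagram`). Hence finite-rank objects act as finitely presentable ones
here, and injectivity can be tested at a stage and then at a large index. -/

lemma IsFactorizationSystem.exists_lift (hf : IsFactorizationSystem E M) {X Y Z W : C}
    {e : X ⟶ Y} {m : Z ⟶ W} {p : X ⟶ Z} {q : Y ⟶ W} (he : E e) (hm : M m)
    (w : e ≫ q = p ≫ m) : ∃ d : Y ⟶ Z, e ≫ d = p ∧ d ≫ m = q := by
  -- Factoring `p` and `q` turns the square into two factorizations of one morphism.
  obtain ⟨S, e₁, m₁, he₁, hm₁, rfl⟩ := hf.fac p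
  obtain ⟨T, e₂, m₂, he₂, hm₂, rfl⟩ := hf.fac q
  obtain ⟨d, ⟨hd, hd'⟩, -⟩ := hf.diagonal (e ≫ e₂) m₂ e₁ (m₁ ≫ m) (hf.left_comp _ _ he he₂) hm₂
    he₁ (hf.right_comp _ _ hm₁ hm) (by simpa using w)
  refine ⟨e₂ ≫ d ≫ m₁, ?_, ?_⟩
  · simp only [Category.assoc] at hd
    rw [reassoc_of% hd]
  · simp [hd']

/-- The `E`-part of `p` is split mono by lifting against `p ≫ m`, and epi, hence invertible. -/
lemma IsFactorizationSystem.right_of_comp (hf : IsFactorizationSystem E M)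
    (hE : ∀ ⦃A B : C⦄ (e : A ⟶ B), E e → Epi e) {X Y Z : C} (p : X ⟶ Y) (m : Y ⟶ Z)
    (hpm : M (p ≫ m)) : M p := by
  obtain ⟨W, e, n, he, hn, rfl⟩ := hf.fac p
  obtain ⟨d, hd, -⟩ := hf.exists_lift (p := 𝟙 X) (q := n ≫ m) he hpm (by simp)
  have := hE e he
  have hd' : d ≫ e = 𝟙 _ := by simp [← cancel_epi e, reassoc_of% hd]
  exact hf.right_comp _ _ (hf.right_iso e ⟨d, hd, hd'⟩) hn

/-- The `E`-quotient represented by a morphism of `E`. -/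
def EQuotient.mk {X Z : C} (e : X ⟶ Z) (he : E e) : EQuotient E X :=
  Quotient.mk (isIsomorphicSetoid _)
    (⟨Under.mk e, he⟩ : ObjectProperty.FullSubcategory fun B : Under X => E B.hom)

lemma EQuotient.exists_iso {X Z Z' : C} {e : X ⟶ Z} {he : E e} {e' : X ⟶ Z'} {he' : E e'}
    (h : EQuotient.mk e he = EQuotient.mk e' he') : ∃ i : Z ≅ Z', e ≫ i.hom = e' := by
  obtain ⟨i⟩ := Quotient.exact h
  let j := (ObjectProperty.ι _).mapIso i
  exact ⟨(Under.forget _).mapIso j, Under.w j.hom⟩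

/-- If an object of a filtered diagram has only finitely many `E`-quotients, then the images of
the connecting morphisms out of it are eventually constant. -/
lemma exists_stable_image (hf : IsFactorizationSystem E M)
    (hE : ∀ ⦃A B : C⦄ (e : A ⟶ B), E e → Epi e) {J : Type*} [Category J]
    (D : J ⥤ C) (j : J) [Finite (EQuotient E (D.obj j))] :
    ∃ (t : J) (τ : j ⟶ t) (Q : C) (e : D.obj j ⟶ Q) (m : Q ⟶ D.obj t),
      E e ∧ e ≫ m = D.map τ ∧ ∀ ⦃k : J⦄ (φ : t ⟶ k), M (m ≫ D.map φ) := by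
  choose Q e m he hm hfac using fun φ : Under j => hf.fac (D.map φ.hom)
  -- Quotients of `D.obj j` that factor through the image at `φ`. Moving further along shrinks this
  -- set, so a minimal one exists.
  let U (φ : Under j) : Set (EQuotient E (D.obj j)) :=
    {q | ∃ (Z : C) (f : D.obj j ⟶ Z) (hf : E f), q = EQuotient.mk f hf ∧ ∃ d, e φ ≫ d = f}
  obtain ⟨φ, hφ⟩ : ∃ φ : Under j, ∀ ψ, ¬ U ψ < U φ := by
    obtain ⟨_, ⟨φ, rfl⟩, h⟩ := WellFounded.has_min (α := Set (EQuotient E (D.obj j)))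
      (wellFounded_lt) (Set.range U) ⟨_, ⟨Under.mk (𝟙 j), rfl⟩⟩
    exact ⟨φ, fun ψ => h _ ⟨ψ, rfl⟩⟩
  refine ⟨φ.right, φ.hom, Q φ, e φ, m φ, he φ, hfac φ, fun k α => ?_⟩
  let ψ : Under j := Under.mk (φ.hom ≫ α)
  obtain ⟨d, hd, hd'⟩ := hf.exists_lift (p := e ψ) (q := m φ ≫ D.map α) (he φ) (hm ψ) (by
    rw [hfac ψ, reassoc_of% (hfac φ)]
    exact (D.map_comp _ _).symm)
  have hle : U ψ ≤ U φ := by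
    rintro _ ⟨Z, f, hf, rfl, d', rfl⟩
    exact ⟨Z, _, hf, rfl, d ≫ d', by rw [reassoc_of% hd]⟩
  -- By minimality the later image is no smaller, so the comparison `d` is invertible.
  have hmem : EQuotient.mk (e φ) (he φ) ∈ U ψ := by
    by_contra hn
    exact hφ ψ (lt_of_le_not_ge hle fun h => hn (h ⟨_, _, he φ, rfl, 𝟙 _, by simp⟩))
  obtain ⟨Z, f, hf', hq, d', hd''⟩ := hmem
  obtain ⟨i, hi⟩ := EQuotient.exists_iso hq
  have h1 : e ψ ≫ d' ≫ i.inv = e φ := by rw [reassoc_of% hd'', ← hi]; simp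
  have := hE _ (he φ)
  have := hE _ (he ψ)
  have : IsIso d := ⟨d' ≫ i.inv, by simp [← cancel_epi (e φ), reassoc_of% hd, h1],
    by rw [← cancel_epi (e ψ)]; simp only [Category.assoc] at h1 ⊢; rw [reassoc_of% h1, hd]; simp⟩
  rw [← hd']
  exact hf.right_comp _ _ (hf.right_iso _ this) (hm ψ)

lemma HasFiniteRank.finite_quotient {A : C} (h : HasFiniteRank E M A) :
    Finite (EQuotient E A) := by
  have : Fact (Cardinal.aleph0.{v}).IsRegular := Cardinal.fact_isRegular_aleph0.{v}
  exact (hasCardinalLT_aleph0_iff _).1 (HasRank.quotients_lt h)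

lemma HasFiniteRank.preservesColimit {A : C} (h : HasFiniteRank E M A) {J : Type v}
    [SmallCategory J] [IsFiltered J] (D : J ⥤ C) (hD : ∀ ⦃i j : J⦄ (f : i ⟶ j), M (D.map f)) :
    PreservesColimit D (coyoneda.obj (op A)) := by
  have : Fact (Cardinal.aleph0.{v}).IsRegular := Cardinal.fact_isRegular_aleph0.{v}
  have : IsCardinalFiltered J Cardinal.aleph0.{v} :=
    (isCardinalFiltered_aleph0_iff.{v} J).2 inferInstance
  exact HasRank.preservesColimit h J D hD

/-- A natural transformation with epimorphic components along which the colimit cocone factors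
induces the same colimit. -/
noncomputable def isColimitOfEpi {J : Type*} [Category J] {D Q : J ⥤ C} (e : D ⟶ Q)
    [∀ j, Epi (e.app j)] {c : Cocone D} (hc : IsColimit c) (c' : Cocone Q) (i : c.pt ≅ c'.pt)
    (h : ∀ j, e.app j ≫ c'.ι.app j = c.ι.app j ≫ i.hom) : IsColimit c' where
  desc s := i.inv ≫ hc.desc ((Cocone.precompose e).obj s)
  fac s j := by
    rw [← cancel_epi (e.app j), reassoc_of% (h j)]
    simp
  uniq s m hm := by
    rw [← cancel_epi i.hom]
    refine hc.hom_ext fun j => ?_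
    rw [← reassoc_of% (h j), hm]
    simp

/-- A filtered diagram of objects of finite rank has the same colimit as the diagram of the
stable images, whose connecting morphisms lie in `M`. -/
lemma exists_image_diagram (hf : IsFactorizationSystem E M)
    (hE : ∀ ⦃A B : C⦄ (e : A ⟶ B), E e → Epi e) {J : Type*} [Category J] [IsFiltered J]
    (D : J ⥤ C) (hD : ∀ j, HasFiniteRank E M (D.obj j)) {c : Cocone D} (hc : IsColimit c) :
    ∃ (Q : J ⥤ C) (e : D ⟶ Q) (c' : Cocone Q) (i : c.pt ≅ c'.pt) (_ : IsColimit c'),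
      (∀ ⦃i j : J⦄ (f : i ⟶ j), M (Q.map f)) ∧
      (∀ j, e.app j ≫ c'.ι.app j = c.ι.app j ≫ i.hom) ∧
      ∀ j, ∃ (t : J) (τ : j ⟶ t) (m : Q.obj j ⟶ D.obj t),
        e.app j ≫ m = D.map τ ∧ m ≫ c.ι.app t ≫ i.hom = c'.ι.app j := by
  have hfin (j : J) : Finite (EQuotient E (D.obj j)) := (hD j).finite_quotient
  choose t τ Q e m he hem hm using fun j => exists_stable_image hf hE D j
  have hepi (j : J) : Epi (e j) := hE _ (he j)
  have hq : ∀ ⦃i j : J⦄ (f : i ⟶ j), ∃ q : Q i ⟶ Q j, e i ≫ q = D.map f ≫ e j ∧ M q := by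
    intro i j f
    obtain ⟨k, a, b, hab⟩ := IsFiltered.span (τ i) (f ≫ τ j)
    obtain ⟨q, hq, hq'⟩ := hf.exists_lift (e := e i) (m := m j ≫ D.map b)
      (p := D.map f ≫ e j) (q := m i ≫ D.map a) (he i) (hm j b) (by
        rw [reassoc_of% (hem i), Category.assoc, reassoc_of% (hem j), ← D.map_comp, hab]
        simp)
    exact ⟨q, hq, hf.right_of_comp hE q _ (hq' ▸ hm i a)⟩
  choose q hq hqM using hq
  let F : J ⥤ C :=
    { obj := Q
      map := fun f => q f
      map_id := fun j => by rw [← cancel_epi (e j), hq]; simp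
      map_comp := fun {i j k} f g => by
        rw [← cancel_epi (e i), hq, reassoc_of% (hq f), hq]; simp }
  let ε : D ⟶ F := { app := e, naturality := fun i j f => (hq f).symm }
  have hm' (j : J) : e j ≫ m j ≫ c.ι.app (t j) = c.ι.app j := by
    rw [reassoc_of% (hem j), c.w]
  let c' : Cocone F :=
    { pt := c.pt
      ι :=
        { app := fun j => m j ≫ c.ι.app (t j)
          naturality := fun i j f => by
            dsimp [F]
            rw [← cancel_epi (e i), reassoc_of% (hq f), hm', Category.comp_id, hm', c.w] } }
  have (j : J) : Epi (ε.app j) := hepi j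
  refine ⟨F, ε, c', Iso.refl _, isColimitOfEpi ε hc c' (Iso.refl _) ?_, hqM, ?_, ?_⟩
  · intro j; simpa using hm' j
  · intro j; simpa using hm' j
  · intro j
    exact ⟨t j, τ j, m j, hem j, by simp [c']⟩

/-- Rank applies to the image diagram; each image embeds in a later `D.obj t`, which carries the
factorization back. -/
lemma exists_fac_of_hasFiniteRank
    (hC : IsStronglyLocallyRanked E M) {J : Type v} [SmallCategory J]
    [IsFiltered J] {D : J ⥤ C} (hD : ∀ j, HasFiniteRank E M (D.obj j)) {c : Cocone D}
    (hc : IsColimit c) {P : C} (hP : HasFiniteRank E M P) (f : P ⟶ c.pt) :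
    ∃ (j : J) (g : P ⟶ D.obj j), g ≫ c.ι.app j = f := by
  obtain ⟨Q, e, c', i, hc', hM, he, ht⟩ :=
    exists_image_diagram hC.factorizationSystem hC.leftProper D hD hc
  have := hP.preservesColimit Q hM
  obtain ⟨j, g, hg⟩ := Types.jointly_surjective_of_isColimit
    (isColimitOfPreserves (coyoneda.obj (op P)) hc') (f ≫ i.hom)
  obtain ⟨t, τ, m, -, hm⟩ := ht j
  refine ⟨t, g ≫ m, ?_⟩
  rw [← cancel_mono i.hom, Category.assoc, Category.assoc, hm]
  exact hg

lemma exists_eq_of_hasFiniteRank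
    (hC : IsStronglyLocallyRanked E M) {J : Type v} [SmallCategory J]
    [IsFiltered J] {D : J ⥤ C} (hD : ∀ j, HasFiniteRank E M (D.obj j)) {c : Cocone D}
    (hc : IsColimit c) {P : C} (hP : HasFiniteRank E M P) {j : J}
    (f g : P ⟶ D.obj j)
    (h : f ≫ c.ι.app j = g ≫ c.ι.app j) :
    ∃ (k : J) (α : j ⟶ k), f ≫ D.map α = g ≫ D.map α := by
  obtain ⟨Q, e, c', i, hc', hM, he, ht⟩ :=
    exists_image_diagram hC.factorizationSystem hC.leftProper D hD hc
  have := hP.preservesColimit Q hM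
  obtain ⟨k, α, hα⟩ := (Types.FilteredColimit.isColimit_eq_iff'
    (isColimitOfPreserves (coyoneda.obj (op P)) hc') (f ≫ e.app j) (g ≫ e.app j)).1 (by
      change (f ≫ e.app j) ≫ c'.ι.app j = (g ≫ e.app j) ≫ c'.ι.app j
      rw [Category.assoc, Category.assoc, he, reassoc_of% h])
  replace hα : (f ≫ e.app j) ≫ Q.map α = (g ≫ e.app j) ≫ Q.map α := hα
  obtain ⟨t, τ, m, hm, -⟩ := ht k
  refine ⟨t, α ≫ τ, ?_⟩
  simp only [Category.assoc] at hα
  rw [D.map_comp, ← hm, e.naturality_assoc, reassoc_of% hα]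

lemma HasFiniteRank.of_isColimit (hC : IsStronglyLocallyRanked E M) {J : Type} [SmallCategory J]
    [FinCategory J] {D : J ⥤ C} {c : Cocone D} (hc : IsColimit c)
    (hD : ∀ j, HasFiniteRank E M (D.obj j)) : HasFiniteRank E M c.pt := by
  have : Fact (Cardinal.aleph0.{v}).IsRegular := Cardinal.fact_isRegular_aleph0.{v}
  refine hC.rank_colimit Cardinal.aleph0.{v} (AsSmall.{v} J) ?_ (AsSmall.down ⋙ D)
    (c.whisker AsSmall.down)
    ((Functor.Final.isColimitWhiskerEquiv (AsSmall.equiv (C := J)).inverse c).symm hc)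
    fun j => hD _
  rw [hasCardinalLT_aleph0_iff]
  have : Finite (Arrow J) := Finite.of_equiv (Σ i j : J, i ⟶ j)
    ⟨fun x => Arrow.mk x.2.2, fun a => ⟨_, _, a.hom⟩, fun _ => rfl, fun _ => rfl⟩
  exact Finite.of_surjective (fun a : Arrow J => Arrow.mk ((AsSmall.up (C := J)).map a.hom))
    fun a => ⟨Arrow.mk (AsSmall.down.map a.hom), rfl⟩

lemma HasFiniteRank.coprod (hC : IsStronglyLocallyRanked E M) {X Y : C} [HasBinaryCoproduct X Y]
    (hX : HasFiniteRank E M X) (hY : HasFiniteRank E M Y) : HasFiniteRank E M (X ⨿ Y) :=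
  HasFiniteRank.of_isColimit hC (colimit.isColimit (pair X Y)) (by rintro (_ | _) <;> assumption)

lemma HasFiniteRank.coequalizer (hC : IsStronglyLocallyRanked E M) {X Y : C} (f g : X ⟶ Y)
    [HasCoequalizer f g] (hX : HasFiniteRank E M X) (hY : HasFiniteRank E M Y) :
    HasFiniteRank E M (coequalizer f g) :=
  HasFiniteRank.of_isColimit hC (colimit.isColimit (parallelPair f g))
    (by rintro (_ | _) <;> assumption)

lemma HasFiniteRank.pushout (hC : IsStronglyLocallyRanked E M) {X Y Z : C} (f : X ⟶ Y)
    (g : X ⟶ Z) [HasPushout f g] (hX : HasFiniteRank E M X) (hY : HasFiniteRank E M Y)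
    (hZ : HasFiniteRank E M Z) : HasFiniteRank E M (pushout f g) :=
  HasFiniteRank.of_isColimit hC (colimit.isColimit (span f g))
    (by rintro (_ | _ | _) <;> assumption)

lemma HasFiniteRank.initial (hC : IsStronglyLocallyRanked E M) [HasInitial C] :
    HasFiniteRank E M (⊥_ C) :=
  HasFiniteRank.of_isColimit hC (colimit.isColimit (Functor.empty.{0} C)) (by rintro ⟨⟨⟩⟩)

lemma IsInjectiveWrt.of_arrow_iso {X : C} {a b : Arrow C} (i : a ≅ b)
    (h : IsInjectiveWrt X a.hom) : IsInjectiveWrt X b.hom := by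
  intro f
  obtain ⟨w, hw⟩ := h (i.hom.left ≫ f)
  refine ⟨i.inv.right ≫ w, ?_⟩
  have : i.inv.left ≫ a.hom = b.hom ≫ i.inv.right := i.inv.w
  rw [← reassoc_of% this, hw, ← Category.assoc, ← Arrow.comp_left, i.inv_hom_id]
  exact Category.id_comp f

/-- The objects of the category of elements of the reduced product of the functors `Hom(-, X i)`
modulo the filter of final segments of `I`, restricted to the objects `obj k`. -/
structure EventualHom {I K : Type v} [Preorder I] (obj : K → C) (X : I → C) : Type v where
  /-- the index of the domain -/
  dom : K
  /-- the index from which on the family is defined -/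
  start : I
  /-- the family of morphisms -/
  map : ∀ i, start ≤ i → (obj dom ⟶ X i)

namespace EventualHom

variable {I K : Type v} [SemilatticeSup I] {obj : K → C} {X : I → C}

/-- Commutation is required only eventually, so families with the same germ and domain are
isomorphic. -/
instance : SmallCategory (EventualHom obj X) where
  Hom x y := { g : obj x.dom ⟶ obj y.dom //
    ∃ t : I, ∀ i (hx : x.start ≤ i) (hy : y.start ≤ i), t ≤ i → g ≫ y.map i hy = x.map i hx }
  id x := ⟨𝟙 _, x.start, by simp⟩
  comp {x y z} f g := ⟨f.1 ≫ g.1, by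
    obtain ⟨f, s, hf⟩ := f
    obtain ⟨g, t, hg⟩ := g
    refine ⟨s ⊔ t ⊔ y.start, fun i hx hz hi => ?_⟩
    have hy : y.start ≤ i := le_sup_right.trans hi
    have hi := le_sup_left.trans hi
    rw [Category.assoc, hg i hy hz (le_sup_right.trans hi), hf i hx hy (le_sup_left.trans hi)]⟩
  id_comp f := Subtype.ext (Category.id_comp _)
  comp_id f := Subtype.ext (Category.comp_id _)
  assoc f g h := Subtype.ext (Category.assoc _ _ _)

variable (obj X) in
/-- The projection from the category of elements. -/
abbrev domain : EventualHom obj X ⥤ C where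
  obj x := obj x.dom
  map g := g.1

lemma cocone_w (c : Cocone (domain obj X)) {x y : EventualHom obj X} (g : x ⟶ y) {P : C}
    (u : P ⟶ obj x.dom) : u ≫ g.1 ≫ c.ι.app y = u ≫ c.ι.app x :=
  congr_arg (u ≫ ·) (c.w g)

lemma exists_mk_hom {x : EventualHom obj X} {R : C} {r : K} (i : obj r ≅ R) (p : obj x.dom ⟶ R)
    (s : I) (h : ∀ i (hx : x.start ≤ i), s ≤ i → ∃ y : R ⟶ X i, p ≫ y = x.map i hx) :
    ∃ (z : EventualHom obj X) (j : obj z.dom ≅ R) (g : x ⟶ z),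
      g.1 ≫ j.hom = p := by
  choose y hy using h
  refine ⟨⟨r, x.start ⊔ s, fun k hk =>
    i.hom ≫ y k (le_sup_left.trans hk) (le_sup_right.trans hk)⟩, i,
    ⟨p ≫ i.inv, s, fun k hx hz _ => by simp [hy]⟩, by simp⟩

end EventualHom

open EventualHom

section

variable {I K : Type v} [SemilatticeSup I] {obj : K → C} {X : I → C}

lemma isFiltered_eventualHom [Nonempty I] (hC : IsStronglyLocallyRanked E M)
    (hobj : ∀ k, HasFiniteRank E M (obj k))
    (hK : ∀ P, HasFiniteRank E M P → ∃ k, Nonempty (obj k ≅ P)) :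
    IsFiltered (EventualHom obj X) := by
  have := hC.cocomplete
  have : HasFiniteColimits C := hasFiniteColimits_of_hasColimits C
  have : IsFilteredOrEmpty (EventualHom obj X) :=
    { cocone_objs := fun x y => by
        obtain ⟨r, ⟨i⟩⟩ := hK _ ((hobj x.dom).coprod hC (hobj y.dom))
        let z : EventualHom obj X := ⟨r, x.start ⊔ y.start, fun k hk =>
          i.hom ≫ coprod.desc (x.map k (le_sup_left.trans hk)) (y.map k (le_sup_right.trans hk))⟩
        exact ⟨z, ⟨coprod.inl ≫ i.inv, x.start, fun k _ _ _ => by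
            simp only [z, Category.assoc, i.inv_hom_id_assoc]
            exact coprod.inl_desc _ _⟩,
          ⟨coprod.inr ≫ i.inv, x.start, fun k _ _ _ => by
            simp only [z, Category.assoc, i.inv_hom_id_assoc]
            exact coprod.inr_desc _ _⟩, trivial⟩
      cocone_maps := fun x y f g => by
        obtain ⟨r, ⟨i⟩⟩ := hK _ ((hobj x.dom).coequalizer hC f.1 g.1 (hobj y.dom))
        obtain ⟨s, hs⟩ := f.2
        obtain ⟨t, ht⟩ := g.2
        obtain ⟨z, j, q, hq⟩ := exists_mk_hom i (coequalizer.π f.1 g.1) (s ⊔ t ⊔ x.start)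
          fun k hy hk => ⟨coequalizer.desc (y.map k hy) (by
            have hx : x.start ≤ k := le_sup_right.trans hk
            have hk := le_sup_left.trans hk
            rw [hs k hx hy (le_sup_left.trans hk), ht k hx hy (le_sup_right.trans hk)]), by simp⟩
        refine ⟨z, q, Subtype.ext ?_⟩
        change f.1 ≫ q.1 = g.1 ≫ q.1
        rw [← cancel_mono j.hom, Category.assoc, Category.assoc, hq, coequalizer.condition] }
  obtain ⟨r, ⟨i⟩⟩ := hK _ (HasFiniteRank.initial hC)
  exact { nonempty := ⟨⟨r, Classical.arbitrary I, fun k _ => i.hom ≫ initial.to _⟩⟩ }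

/-- The colimit of the elements of the reduced product is injective with respect to every
finitary morphism with respect to which almost all factors are injective. -/
lemma isInjectiveWrt_of_eventually (hC : IsStronglyLocallyRanked E M)
    (hobj : ∀ k, HasFiniteRank E M (obj k))
    (hK : ∀ P, HasFiniteRank E M P → ∃ k, Nonempty (obj k ≅ P))
    [IsFiltered (EventualHom obj X)] {c : Cocone (domain obj X)} (hc : IsColimit c)
    {P Q : C} (f : P ⟶ Q) (hf : IsFinitary E M f)
    (s : I) (hs : ∀ i, s ≤ i → IsInjectiveWrt (X i) f) : IsInjectiveWrt c.pt f := by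
  have := hC.cocomplete
  intro u
  obtain ⟨x, (u : P ⟶ obj x.dom), rfl⟩ :=
    exists_fac_of_hasFiniteRank hC (fun x => hobj x.dom) hc hf.1 u
  -- The pushout glues extensions chosen independently at each index past `s`.
  obtain ⟨r, ⟨i⟩⟩ := hK _ (HasFiniteRank.pushout hC f u hf.1 hf.2 (hobj x.dom))
  obtain ⟨z, j, g, hg⟩ := exists_mk_hom i (pushout.inr f u) s fun k hx hk => by
    obtain ⟨w, hw⟩ := hs k hk (u ≫ x.map k hx)
    exact ⟨pushout.desc w (x.map k hx) hw, pushout.inr_desc _ _ _⟩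
  refine ⟨pushout.inl f u ≫ j.inv ≫ c.ι.app z, ?_⟩
  rw [pushout.condition_assoc, ← hg, Category.assoc, j.hom_inv_id_assoc]
  exact cocone_w c g u

/-- The colimit of the elements of the reduced product is not injective with respect to a
finitary morphism with respect to which no factor is injective. -/
lemma not_isInjectiveWrt_of_forall (hC : IsStronglyLocallyRanked E M)
    (hobj : ∀ k, HasFiniteRank E M (obj k))
    (hK : ∀ P, HasFiniteRank E M P → ∃ k, Nonempty (obj k ≅ P)) [Nonempty I]
    [IsFiltered (EventualHom obj X)] {c : Cocone (domain obj X)} (hc : IsColimit c)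
    {A B : C} (h : A ⟶ B) (hh : IsFinitary E M h)
    (hX : ∀ i, ¬ IsInjectiveWrt (X i) h) : ¬ IsInjectiveWrt c.pt h := by
  intro hinj
  simp only [IsInjectiveWrt, not_forall] at hX
  choose u hu using hX
  obtain ⟨a, ⟨e⟩⟩ := hK _ hh.1
  -- The non-extendable morphisms form a single element of the index category.
  let x : EventualHom obj X := ⟨a, Classical.arbitrary I, fun i _ => e.hom ≫ u i⟩
  obtain ⟨w, hw⟩ := hinj (e.inv ≫ c.ι.app x)
  obtain ⟨y, (w : B ⟶ obj y.dom), rfl⟩ :=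
    exists_fac_of_hasFiniteRank hC (fun x => hobj x.dom) hc hh.2 w
  let z := IsFiltered.max x y
  let α : x ⟶ z := IsFiltered.leftToMax x y
  let β : y ⟶ z := IsFiltered.rightToMax x y
  obtain ⟨t, γ, hγ⟩ := exists_eq_of_hasFiniteRank hC (fun x => hobj x.dom) hc hh.1 (j := z)
    ((h ≫ w) ≫ β.1) (e.inv ≫ α.1) (by
      rw [Category.assoc, Category.assoc, cocone_w, Category.assoc]
      exact hw.trans (cocone_w c α e.inv).symm)
  obtain ⟨s₁, h₁⟩ := (α ≫ γ).2
  obtain ⟨s₂, h₂⟩ := (β ≫ γ).2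
  -- Past all thresholds, the extension found at stage `t` restricts to an extension of `u k`.
  let k := s₁ ⊔ s₂ ⊔ (x.start ⊔ y.start ⊔ t.start)
  have hs₁ : s₁ ≤ k := le_sup_left.trans le_sup_left
  have hs₂ : s₂ ≤ k := le_sup_right.trans le_sup_left
  have hx : x.start ≤ k := le_sup_left.trans (le_sup_left.trans le_sup_right)
  have hy : y.start ≤ k := le_sup_right.trans (le_sup_left.trans le_sup_right)
  have ht : t.start ≤ k := le_sup_right.trans le_sup_right
  refine hu k ⟨w ≫ y.map k hy, ?_⟩
  rw [← h₂ k hy ht hs₂]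
  have hγ' : h ≫ w ≫ (β ≫ γ).1 = e.inv ≫ (α ≫ γ).1 := by
    change h ≫ w ≫ β.1 ≫ γ.1 = e.inv ≫ α.1 ≫ γ.1
    simpa only [Category.assoc] using hγ
  rw [reassoc_of% hγ', h₁ k hx ht hs₁]
  exact e.inv_hom_id_assoc _

end

lemma exists_small_family (hC : IsStronglyLocallyRanked E M) :
    ∃ (K : Type v) (obj : K → C), (∀ k, HasFiniteRank E M (obj k)) ∧
      ∀ P, HasFiniteRank E M P → ∃ k, Nonempty (obj k ≅ P) := by
  have : Fact (Cardinal.aleph0.{v}).IsRegular := Cardinal.fact_isRegular_aleph0.{v}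
  have := hC.essentiallySmall_rank Cardinal.aleph0.{v}
  obtain ⟨Q, _, hQ, hQ'⟩ := ObjectProperty.EssentiallySmall.exists_small_le.{v}
    (rankProperty E M Cardinal.aleph0.{v})
  refine ⟨Shrink.{v} (Subtype Q), fun k => ((equivShrink _).symm k).1,
    fun k => hQ _ ((equivShrink _).symm k).2, fun P hP => ?_⟩
  obtain ⟨Y, hY, ⟨i⟩⟩ := hQ' P hP
  refine ⟨equivShrink _ ⟨Y, hY⟩, ⟨?_⟩⟩
  dsimp only
  rw [Equiv.symm_apply_apply]
  exact i.symm

end InjectivityLogic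

open CategoryTheory Limits InjectivityLogic in
theorem corollary6p4 {C : Type u} [CategoryTheory.Category.{v} C]
    (E M : CategoryTheory.MorphismProperty C)
    (hC : InjectivityLogic.IsStronglyLocallyRanked E M)
    (H : Set (CategoryTheory.Arrow C))
    (hH : ∀ f ∈ H, InjectivityLogic.IsFinitary E M f.hom)
    {A B : C} (h : A ⟶ B) (hh : InjectivityLogic.IsFinitary E M h)
    (hcons : InjectivityLogic.IsInjectivityConsequence H h) :
    ∃ H' : Set (CategoryTheory.Arrow C), H' ⊆ H ∧ H'.Finite ∧
      InjectivityLogic.IsInjectivityConsequence H' h := by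
  classical
  by_contra! hcon
  have := hC.cocomplete
  obtain ⟨K, obj, hobj, hK⟩ := exists_small_family hC
  let arr (a : Σ k l : K, obj k ⟶ obj l) : Arrow C := Arrow.mk a.2.2
  -- `H` need not be small; `T` represents its members up to isomorphism by a small set, so `Finset
  -- T` can index the `X i`.
  let T := { a : Σ k l : K, obj k ⟶ obj l // ∃ f ∈ H, Nonempty (f ≅ arr a) }
  choose f hf hf' using fun a : T => a.2
  have key (i : Finset T) : ∃ X : C, (∀ a ∈ i, IsInjectiveWrt X (f a).hom) ∧
      ¬ IsInjectiveWrt X h := by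
    have := hcon (f '' i) (by rintro _ ⟨a, -, rfl⟩; exact hf a) (i.finite_toSet.image f)
    simp only [IsInjectivityConsequence, not_forall] at this
    obtain ⟨X, hX, hX'⟩ := this
    exact ⟨X, fun a ha => hX _ ⟨a, ha, rfl⟩, hX'⟩
  choose X hX hX' using key
  have := isFiltered_eventualHom (X := X) hC hobj hK
  refine not_isInjectiveWrt_of_forall hC hobj hK (colimit.isColimit (EventualHom.domain obj X)) h hh hX'
    (hcons _ fun g hg => ?_)
  obtain ⟨k, ⟨i⟩⟩ := hK _ (hH g hg).1
  obtain ⟨l, ⟨j⟩⟩ := hK _ (hH g hg).2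
  let a : T := ⟨⟨k, l, i.hom ≫ g.hom ≫ j.inv⟩, g, hg,
    ⟨Arrow.isoMk i.symm j.symm (by simp [arr])⟩⟩
  exact isInjectiveWrt_of_eventually hC hobj hK (colimit.isColimit (EventualHom.domain obj X)) g.hom (hH g hg)
    {a} fun s hs => ((hX s a (hs (Finset.mem_singleton_self a))).of_arrow_iso
      (hf' a).some).of_arrow_iso (Arrow.isoMk i j (by simp [arr, a]))
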